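/- Call a germ of regular \(d\)-web on \((\mathbb{C}^2,0)\) a collection \(\mathcal{W}=\mathcal{F}_1\boxtimes\cdots\boxtimes\mathcal{F}_d\) of germs of foliations \(\mathcal{F}_i=\ker(\omega_i)\), where \(\omega_i=a_i\,dx+b_i\,dy\) is a germ of holomorphic \(1\)-form that does not vanish at \(0\), and \(\omega_i\wedge\omega_j\) does not vanish at \(0\) for \(i\neq j\). \(\mathcal{W}\) is parallelizable if there are local holomorphic coordinates at \(0\) in which each \(\mathcal{F}_i\) is defined by a \(1\)-form with constant coefficients. A \(3\)-web is called hexagonal if it is parallelizable, and \(\mathcal{W}\) is hexagonal if every \(3\)-web extracted from it is hexagonal. \(\mathcal{W}\) has constant cross-ratio if for any four distinct indices \(i,j,k,l\) the cross-ratio \[ (\mathcal{F}_i,\mathcal{F}_j;\mathcal{F}_k,\mathcal{F}_l)=\frac{(e_i-e_k)(e_j-e_l)}{(e_j-e_k)(e_i-e_l)},\qquad e_i=-\frac{a_i}{b_i}, \] is constant near \(0\) (the cross-ratio is intrinsically defined, also where some \(b_i\) vanishes, as \(\frac{(\omega_i\wedge\omega_k)(\omega_j\wedge\omega_l)}{(\omega_j\wedge\omega_k)(\omega_i\wedge\omega_l)}\)).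 A pencil of foliations on \((\mathbb{C}^2,0)\) is a family \(\mathcal{F}_t=\ker(\omega_0-t\omega_\infty)\), \(t\in\mathbb{P}^1\) (with \(\mathcal{F}_\infty=\ker\omega_\infty\)), where \(\omega_0=f_0\,dx+g_0\,dy\) and \(\omega_\infty=f_\infty\,dx+g_\infty\,dy\) are germs of holomorphic \(1\)-forms such that \(\delta:=f_0g_\infty-g_0f_\infty\) does not vanish at \(0\). The web \(\mathcal{W}\) is contained in the pencil if each \(\mathcal{F}_i\) equals some \(\mathcal{F}_t\), \(t\in\mathbb{P}^1\). The pencil has an associated Riccati form \(dz+\alpha z^2+\beta z+\gamma\) with \[ \alpha=\frac{g_0\,dg_\infty-g_\infty\,dg_0}{\delta},\quad \beta=\frac{f_0\,dg_\infty-g_\infty\,df_0+g_0\,df_\infty-f_\infty\,dg_0}{\delta},\quad \gamma=\frac{f_0\,df_\infty-f_\infty\,df_0}{\delta}. \] Writing \(\alpha=\alpha_1dx+\alpha_2dy\), \(\beta=\beta_1dx+\beta_2dy\), \(\gamma=\gamma_1dx+\gamma_2dy\), put \(\kappa=(2\gamma_2-\beta_1)\,dx+(\beta_2-2\alpha_1)\,dy\).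 The pencil is torsion-free if \(d\kappa=0\) near \(0\). Proposition. Let \(\mathcal{W}\) be a germ of regular \(d\)-web on \((\mathbb{C}^2,0)\) with \(d>3\). Then \(\mathcal{W}\) is contained in a pencil of foliations \(\{\mathcal{F}_t\}_{t\in\mathbb{P}^1}\) if and only if \(\mathcal{W}\) has constant cross-ratio. In that case, for any pencil \(\{\mathcal{F}_t\}_{t\in\mathbb{P}^1}\) containing \(\mathcal{W}\), the following are equivalent: (1) \(\mathcal{W}\) is parallelizable; (2) \(\mathcal{W}\) is hexagonal; (3) the pencil \(\{\mathcal{F}_t\}_{t\in\mathbb{P}^1}\) is torsion-free, i.e. \(d\kappa=0\). -/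

import Mathlib

open scoped Topology

noncomputable section

namespace PlaneWeb

/-- A differential `1`-form `a(x,y) dx + b(x,y) dy` on `ℂ²`, as a field of linear forms. Only its
germ at the origin is ever used. -/
abbrev OneForm : Type := ℂ × ℂ → (ℂ × ℂ →L[ℂ] ℂ)

namespace OneForm

/-- The coefficient of `dx`. -/
def coeffX (ω : OneForm) (z : ℂ × ℂ) : ℂ := ω z (1, 0)

/-- The coefficient of `dy`. -/
def coeffY (ω : OneForm) (z : ℂ × ℂ) : ℂ := ω z (0, 1)

/-- The coefficient of `dx ∧ dy` in `ω ∧ η`. -/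
def wedge (ω η : OneForm) (z : ℂ × ℂ) : ℂ :=
  ω.coeffX z * η.coeffY z - ω.coeffY z * η.coeffX z

/-- The exterior derivative of a `1`-form, a field of alternating `2`-forms. -/
def d (ω : OneForm) : ℂ × ℂ → (ℂ × ℂ) [⋀^Fin 2]→L[ℂ] ℂ :=
  extDeriv fun z => ContinuousAlternatingMap.ofSubsingleton ℂ (ℂ × ℂ) ℂ (0 : Fin 1) (ω z)

/-- `ker ω = ker η` near the origin: both `1`-forms define the same germ of foliation. -/
def SameKernel (ω η : OneForm) : Prop :=
  ∀ᶠ z in 𝓝 (0 : ℂ × ℂ), ∀ v : ℂ × ℂ, ω z v = 0 ↔ η z v = 0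

end OneForm

/-- A germ of regular holomorphic foliation `ker ω` on `(ℂ², 0)`, presented by a germ of
holomorphic `1`-form `ω` that does not vanish at the origin. -/
structure RegularFoliation where
  form : OneForm
  analyticAt : AnalyticAt ℂ form 0
  ne_zero : form 0 ≠ 0

/-- A germ of regular `d`-web `F₁ ⊠ ⋯ ⊠ F_d` on `(ℂ², 0)`: regular foliations that are pairwise
transversal (at the origin, hence in a neighbourhood of it). -/
structure RegularWeb (d : ℕ) where
  foliation : Fin d → RegularFoliation
  transversal : ∀ i j, i ≠ j → (foliation i).form.wedge (foliation j).form 0 ≠ 0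

/-- A germ of holomorphic change of coordinates `(ℂ², 0) → (ℂ², 0)`. -/
structure IsCoordinateChange (φ : ℂ × ℂ → ℂ × ℂ) : Prop where
  analyticAt : AnalyticAt ℂ φ 0
  map_zero : φ 0 = 0
  invertible : (fderiv ℂ φ 0).IsInvertible

/-- The cross-ratio of the foliations defined by four `1`-forms `ω₁, ω₂, ω₃, ω₄`, in homogeneous
form, so that no assumption on the vertical direction is needed. For slopes `eᵢ = - aᵢ / bᵢ` it is
`(e₁ - e₃)(e₂ - e₄) / ((e₂ - e₃)(e₁ - e₄))`, see `crossRatio_eq_slopes`. -/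
def crossRatio (ω₁ ω₂ ω₃ ω₄ : OneForm) (z : ℂ × ℂ) : ℂ :=
  (ω₁.wedge ω₃ z * ω₂.wedge ω₄ z) / (ω₂.wedge ω₃ z * ω₁.wedge ω₄ z)

theorem crossRatio_eq_slopes (ω : Fin 4 → OneForm) (z : ℂ × ℂ)
    (hb : ∀ i, (ω i).coeffY z ≠ 0) (e : Fin 4 → ℂ)
    (he : ∀ i, e i = - (ω i).coeffX z / (ω i).coeffY z) :
    crossRatio (ω 0) (ω 1) (ω 2) (ω 3) z =
      ((e 0 - e 2) * (e 1 - e 3)) / ((e 1 - e 2) * (e 0 - e 3)) := by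
  have key : ∀ i j, (ω i).wedge (ω j) z =
      -((ω i).coeffY z * (ω j).coeffY z) * (e i - e j) := by
    intro i j
    have hi := hb i
    have hj := hb j
    rw [he i, he j, OneForm.wedge]
    field_simp
    ring
  have h0 := hb 0
  have h1 := hb 1
  have h2 := hb 2
  have h3 := hb 3
  rw [crossRatio, key 0 2, key 1 3, key 1 2, key 0 3]
  rw [show -((ω 0).coeffY z * (ω 2).coeffY z) * (e 0 - e 2) *
      (-((ω 1).coeffY z * (ω 3).coeffY z) * (e 1 - e 3)) =
      ((ω 0).coeffY z * (ω 1).coeffY z * (ω 2).coeffY z * (ω 3).coeffY z) *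
        ((e 0 - e 2) * (e 1 - e 3)) by ring,
    show -((ω 1).coeffY z * (ω 2).coeffY z) * (e 1 - e 2) *
      (-((ω 0).coeffY z * (ω 3).coeffY z) * (e 0 - e 3)) =
      ((ω 0).coeffY z * (ω 1).coeffY z * (ω 2).coeffY z * (ω 3).coeffY z) *
        ((e 1 - e 2) * (e 0 - e 3)) by ring]
  exact mul_div_mul_left _ _ (by simp [h0, h1, h2, h3])

/-- A pencil of foliations `F_t = ker (ω₀ - t ω_∞)`, `t ∈ ℙ¹`, on `(ℂ², 0)`, with
`ω₀ ∧ ω_∞` nowhere zero. -/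
structure Pencil where
  ωzero : OneForm
  ωinfty : OneForm
  analyticAt_zero : AnalyticAt ℂ ωzero 0
  analyticAt_infty : AnalyticAt ℂ ωinfty 0
  transversal : ωzero.wedge ωinfty 0 ≠ 0

/-- The form defining the member `F_t` of the pencil, `t ∈ ℙ¹ = ℂ ∪ {∞}`. -/
def Pencil.member (P : Pencil) (t : OnePoint ℂ) : OneForm :=
  t.elim P.ωinfty fun s z => P.ωzero z - s • P.ωinfty z

namespace RegularWeb

variable {d : ℕ}

/-- The web extracted from `W` along an injective choice of indices. -/
def extract {k : ℕ} (W : RegularWeb d) (σ : Fin k ↪ Fin d) : RegularWeb k where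
  foliation i := W.foliation (σ i)
  transversal i j h := W.transversal (σ i) (σ j) (σ.injective.ne h)

/-- In suitable coordinates `φ`, the foliations are defined by `1`-forms `cᵢ` with constant
coefficients; `cᵢ ∘ dφ` is the pull-back of `cᵢ` by `φ`. -/
def IsParallelizable (W : RegularWeb d) : Prop :=
  ∃ φ : ℂ × ℂ → ℂ × ℂ, IsCoordinateChange φ ∧
    ∃ c : Fin d → (ℂ × ℂ →L[ℂ] ℂ),
      ∀ i, (W.foliation i).form.SameKernel fun z => (c i).comp (fderiv ℂ φ z)

/-- All extracted `3`-webs are hexagonal, where a `3`-web is called hexagonal when it is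
parallelizable. -/
def IsHexagonal (W : RegularWeb d) : Prop :=
  ∀ σ : Fin 3 ↪ Fin d, (W.extract σ).IsParallelizable

/-- All extracted `4`-webs have a constant cross-ratio. -/
def HasConstantCrossRatio (W : RegularWeb d) : Prop :=
  ∀ σ : Fin 4 ↪ Fin d, ∃ c : ℂ, ∀ᶠ z in 𝓝 (0 : ℂ × ℂ),
    crossRatio (W.foliation (σ 0)).form (W.foliation (σ 1)).form
      (W.foliation (σ 2)).form (W.foliation (σ 3)).form z = c

/-- Each foliation of the web is a member of the pencil. -/
def IsContainedIn (W : RegularWeb d) (P : Pencil) : Prop :=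
  ∀ i, ∃ t : OnePoint ℂ, (W.foliation i).form.SameKernel (P.member t)

end RegularWeb

/-- A Riccati form `dz + α z² + β z + γ` on the projectivized tangent bundle, where `(1 : z)` is the
direction of `∂_x + z ∂_y`. -/
structure RiccatiForm where
  α : OneForm
  β : OneForm
  γ : OneForm

/-- The `1`-form `κ = (2 γ₂ - β₁) dx + (β₂ - 2 α₁) dy`, the trace of the unique torsion-free lift of
the Riccati form to a linear connection on the tangent bundle. -/
def RiccatiForm.kappa (R : RiccatiForm) : OneForm := fun z =>
  (2 * R.γ.coeffY z - R.β.coeffX z) • ContinuousLinearMap.fst ℂ ℂ ℂ +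
    (R.β.coeffY z - 2 * R.α.coeffX z) • ContinuousLinearMap.snd ℂ ℂ ℂ

/-- The torsion `dκ` vanishes near the origin. -/
def RiccatiForm.IsTorsionFree (R : RiccatiForm) : Prop :=
  ∀ᶠ z in 𝓝 (0 : ℂ × ℂ), R.kappa.d z = 0

/-- The Riccati form of the pencil `(f₀ dx + g₀ dy) - t (f_∞ dx + g_∞ dy)`, that is, the one with
first integral `(f₀ + z g₀) / (f_∞ + z g_∞)`. Here `δ = f₀ g_∞ - g₀ f_∞`. -/
def Pencil.riccati (P : Pencil) : RiccatiForm :=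
  let f₀ := P.ωzero.coeffX
  let g₀ := P.ωzero.coeffY
  let f₁ := P.ωinfty.coeffX
  let g₁ := P.ωinfty.coeffY
  let δ := P.ωzero.wedge P.ωinfty
  { α := fun z => (δ z)⁻¹ • (g₀ z • fderiv ℂ g₁ z - g₁ z • fderiv ℂ g₀ z)
    β := fun z => (δ z)⁻¹ •
      (f₀ z • fderiv ℂ g₁ z - g₁ z • fderiv ℂ f₀ z + g₀ z • fderiv ℂ f₁ z - f₁ z • fderiv ℂ g₀ z)
    γ := fun z => (δ z)⁻¹ • (f₀ z • fderiv ℂ f₁ z - f₁ z • fderiv ℂ f₀ z) }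

/-- A pencil is torsion-free when its Riccati foliation is, i.e. `dκ = 0`. -/
def Pencil.IsTorsionFree (P : Pencil) : Prop := P.riccati.IsTorsionFree

end PlaneWeb

end

/-! Three pairwise transversal forms can be rescaled so that one is the sum of the other two
(`covectorWedge_cyclic`). The pencil spanned by these two then contains the first three foliations,
at `t = 0, ∞, -1`. The parameter of a fourth foliation in it is a function of the cross-ratio, hence
constant exactly when the cross-ratio is (`HasConstantCrossRatio.exists_pencil`).

For the torsion, let `η` be the unique form with `dω₀ = η ∧ ω₀` and `dω_∞ = η ∧ ω_∞`. A computation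
gives `η = (-κ + d log δ) / 2`, so `dκ = 0` iff `dη = 0`.

If `η = dg`, then `exp (-g)` is a common integrating factor. Primitives of `exp (-g) ω₀` and `exp
(-g) ω_∞` are coordinates in which every member of the pencil has constant coefficients
(`IsTorsionFree.exists_coordinateChange`).

Conversely, one parallelizable `3`-subweb suffices. A projective map of `ℙ¹` is determined by three
points, so the coordinates that straighten three members straighten the whole pencil: `ω₀ = μ df`
and `ω_∞ = μ dg` (`exists_common_multiple`). Then `η = d log μ` is closed. -/

/-! ### Analytic primitives of closed `1`-forms -/

section Primitive

variable {E F : Type*} [NormedAddCommGroup E] [NormedSpace ℂ E] [NormedAddCommGroup F]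
  [NormedSpace ℂ F] [CompleteSpace F]

/-- A function whose derivative near `0` is analytic at `0` is itself analytic at `0`. -/
theorem analyticAt_of_eventually_hasFDerivAt {f : E → F} {ω : E → E →L[ℂ] F}
    (hω : AnalyticAt ℂ ω 0) (hf : ∀ᶠ z in 𝓝 (0 : E), HasFDerivAt f (ω z) z) :
    AnalyticAt ℂ f 0 := by
  obtain ⟨p, r, hp⟩ := hω
  obtain ⟨ε, hε, hf⟩ := Metric.eventually_nhds_iff_ball.1 hf
  -- Integrating `ω` term by term along rays divides the term of degree `n` of the unshifted series
  -- by `n`; the constant term `f 0` keeps the factor `1`.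
  let c : ℕ → ℂ := fun n => if n = 0 then 1 else (n : ℂ)⁻¹
  let q : FormalMultilinearSeries ℂ E F := fun n => c n • p.unshift (f 0) n
  have hc : ∀ n, ‖c n‖ ≤ 1 := by
    intro n
    rcases Nat.eq_zero_or_pos n with rfl | hn
    · simp [c]
    · have : (1 : ℝ) ≤ n := by exact_mod_cast hn
      simpa [c, hn.ne'] using inv_le_one_of_one_le₀ this
  have hq : p.radius ≤ q.radius := by
    rw [← p.radius_unshift (f 0)]
    refine FormalMultilinearSeries.radius_le_of_le fun n => ?_
    calc ‖q n‖ = ‖c n‖ * ‖p.unshift (f 0) n‖ := norm_smul (c n) (p.unshift (f 0) n)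
      _ ≤ 1 * ‖p.unshift (f 0) n‖ := by gcongr; exact hc n
      _ = _ := one_mul _
  refine ⟨q, min r (ENNReal.ofReal (ε / 2)), (min_le_left _ _).trans (hp.r_le.trans hq),
    lt_min hp.r_pos (by simpa using hε), fun {z} hz => ?_⟩
  have hzr : z ∈ Metric.eball (0 : E) r := Metric.eball_subset_eball (min_le_left _ _) hz
  have hzε : ‖z‖ < ε / 2 := by
    have h := Metric.eball_subset_eball (min_le_right _ _) hz
    rwa [Metric.eball_ofReal, mem_ball_zero_iff] at h
  -- The bound `‖z‖ < ε / 2` keeps `t • z` in the `ε`-ball for `‖t‖ < 2`, so the one-variable Taylor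
  -- series of `t ↦ f (t • z)` may be evaluated at `t = 1`.
  have hline : ∀ t ∈ Metric.ball (0 : ℂ) 2,
      HasDerivAt (fun s : ℂ => f (s • z)) (ω (t • z) z) t := by
    intro t ht
    have htz : t • z ∈ Metric.ball (0 : E) ε := by
      rw [mem_ball_zero_iff] at ht ⊢
      rw [norm_smul]
      nlinarith [norm_nonneg z, norm_nonneg t]
    have h1 : HasDerivAt (fun s : ℂ => s • z) z t := by
      simpa using (hasDerivAt_id t).smul_const z
    exact (hf _ htz).comp_hasDerivAt t h1
  have hdiff : DifferentiableOn ℂ (fun s : ℂ => f (s • z)) (Metric.ball 0 2) :=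
    fun t ht => (hline t ht).differentiableAt.differentiableWithinAt
  have hderiv : deriv (fun s : ℂ => f (s • z)) =ᶠ[𝓝 0] fun t => ω (t • z) z := by
    filter_upwards [Metric.ball_mem_nhds (0 : ℂ) two_pos] with t ht
    exact (hline t ht).deriv
  have hps : HasFPowerSeriesAt (fun t : ℂ => ω (t • z) z)
      (fun n => ContinuousMultilinearMap.mkPiRing ℂ (Fin n) (p n (fun _ => z) z)) 0 := by
    refine hasFPowerSeriesAt_iff.2 ?_
    have hnear : ∀ᶠ t : ℂ in 𝓝 0, t • z ∈ Metric.eball (0 : E) r := by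
      have hcont : ContinuousAt (fun t : ℂ => t • z) 0 := by fun_prop
      refine hcont.eventually_mem ?_
      simpa using Metric.eball_mem_nhds (0 : E) hp.r_pos
    filter_upwards [hnear] with t ht
    have h1 := (hp.hasSum ht).mapL (ContinuousLinearMap.apply ℂ F z)
    simpa [FormalMultilinearSeries.coeff, ContinuousMultilinearMap.map_smul_univ] using h1
  have hiter : ∀ n, iteratedDeriv n (fun t : ℂ => ω (t • z) z) 0 =
      n.factorial • p n (fun _ => z) z := by
    intro n
    obtain ⟨ρ, hρ⟩ := hps
    have h1 := hρ.factorial_smul 1 n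
    rw [iteratedDeriv, ← h1]
    simp
  have hsum := Complex.hasSum_taylorSeries_on_ball hdiff (z := 1) (by simp)
  simp only [one_smul, sub_zero, one_pow] at hsum
  rw [zero_add]
  convert hsum using 2 with n
  rcases n with _ | n
  · simp [q, c, FormalMultilinearSeries.unshift]
  · rw [iteratedDeriv_succ', hderiv.iteratedDeriv_eq n, hiter n]
    have h1 : ((n.factorial : ℕ) : ℂ) ≠ 0 := by exact_mod_cast n.factorial_ne_zero
    have h2 : ((n : ℂ) + 1) ≠ 0 := by exact_mod_cast n.succ_ne_zero
    have h3 : (p.unshift (f 0) (n + 1)) (fun _ => z) = p n (fun _ => z) z := by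
      simp [FormalMultilinearSeries.unshift, Fin.init_def]
    have h4 : c (n + 1) = ((n : ℂ) + 1)⁻¹ := by simp [c]
    have h5 : q (n + 1) (fun _ => z) = c (n + 1) • p n (fun _ => z) z := by
      rw [← h3]; rfl
    rw [h5, h4, ← Nat.cast_smul_eq_nsmul ℂ, smul_smul, Nat.factorial_succ]
    congr 1
    push_cast
    field_simp

/-- A field of covectors is closed near `0` when its derivative is symmetric near `0`. -/
def IsClosedNearZero (ω : E → E →L[ℂ] F) : Prop :=
  ∀ᶠ z in 𝓝 (0 : E), ∀ u v, fderiv ℂ ω z u v = fderiv ℂ ω z v u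

/-- Poincaré lemma for germs of analytic `1`-forms. -/
theorem IsClosedNearZero.exists_primitive {ω : E → E →L[ℂ] F} (hc : IsClosedNearZero ω)
    (hω : AnalyticAt ℂ ω 0) :
    ∃ f : E → F, AnalyticAt ℂ f 0 ∧ ∀ᶠ z in 𝓝 (0 : E), HasFDerivAt f (ω z) z := by
  -- The Poincaré lemma on convex sets differentiates `ω` over `ℝ`, while the primitive it returns
  -- is complex differentiable.
  let : NormedSpace ℝ E := NormedSpace.restrictScalars ℝ ℂ E
  let : NormedSpace ℝ F := NormedSpace.restrictScalars ℝ ℂ F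
  obtain ⟨ε, hε, h⟩ := Metric.eventually_nhds_iff_ball.1
    (hc.and hω.eventually_analyticAt)
  have hd : ∀ z ∈ Metric.ball (0 : E) ε,
      HasFDerivAt ω ((fderiv ℂ ω z).restrictScalars ℝ) z := fun z hz =>
    (h z hz).2.differentiableAt.hasFDerivAt.restrictScalars ℝ
  obtain ⟨f, hf⟩ := (convex_ball (0 : E) ε).exists_forall_hasFDerivAt_of_fderiv_symmetric
    (𝕜 := ℂ) (ω := ω) Metric.isOpen_ball
    (fun z hz => (hd z hz).differentiableAt.differentiableWithinAt) (fun z hz u v => by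
      rw [(hd z hz).fderiv]
      exact (h z hz).1 u v)
  have hev : ∀ᶠ z in 𝓝 (0 : E), HasFDerivAt f (ω z) z := by
    filter_upwards [Metric.ball_mem_nhds (0 : E) hε] with z hz using hf z hz
  exact ⟨f, analyticAt_of_eventually_hasFDerivAt hω hev, hev⟩

end Primitive

namespace PlaneWeb

/-! ### Covectors of the plane -/

/-- The value of `α ∧ β` on the standard basis. -/
noncomputable def covectorWedge (α β : ℂ × ℂ →L[ℂ] ℂ) : ℂ := α (1, 0) * β (0, 1) - α (0, 1) * β (1, 0)

theorem OneForm.wedge_eq_covectorWedge (ω η : OneForm) (z : ℂ × ℂ) :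
    ω.wedge η z = covectorWedge (ω z) (η z) := rfl

theorem covector_apply (α : ℂ × ℂ →L[ℂ] ℂ) (v : ℂ × ℂ) :
    α v = v.1 * α (1, 0) + v.2 * α (0, 1) := by
  have h : v = v.1 • ((1, 0) : ℂ × ℂ) + v.2 • ((0, 1) : ℂ × ℂ) := by ext <;> simp
  conv_lhs => rw [h]
  simp only [map_add, map_smul, smul_eq_mul]

theorem covector_ext {α β : ℂ × ℂ →L[ℂ] ℂ} (h₁ : α (1, 0) = β (1, 0))
    (h₂ : α (0, 1) = β (0, 1)) : α = β := by
  ext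
  · simpa using h₁
  · simpa using h₂

/-- Two covectors with the same kernel are proportional. -/
theorem exists_eq_smul_of_same_kernel {α β : ℂ × ℂ →L[ℂ] ℂ} (h : ∀ v, α v = 0 ↔ β v = 0) :
    ∃ u : ℂ, u ≠ 0 ∧ α = u • β := by
  by_cases hβ : ∀ v, β v = 0
  · refine ⟨1, one_ne_zero, ?_⟩
    ext1 <;> ext <;> simp [hβ, (h _).2 (hβ _)]
  · obtain ⟨e, he⟩ := not_forall.1 hβ
    refine ⟨α e / β e, div_ne_zero (fun h' => he ((h e).1 h')) he, ContinuousLinearMap.ext fun v => ?_⟩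
    -- This vector lies in the kernel of `β`, hence in that of `α`.
    have h1 : α (β e • v - β v • e) = 0 := by
      rw [h]
      simp [mul_comm]
    simp only [map_sub, map_smul, smul_eq_mul] at h1
    simp only [smul_apply, smul_eq_mul]
    field_simp
    linear_combination h1

theorem covectorWedge_smul_smul (u v : ℂ) (α β : ℂ × ℂ →L[ℂ] ℂ) :
    covectorWedge (u • α) (v • β) = u * v * covectorWedge α β := by
  simp [covectorWedge]; ring

theorem covectorWedge_combination (a b a' b' : ℂ) (α β : ℂ × ℂ →L[ℂ] ℂ) :
    covectorWedge (a • α + b • β) (a' • α + b' • β) = (a * b' - b * a') * covectorWedge α β := by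
  simp [covectorWedge]; ring

theorem covectorWedge_comp (α β : ℂ × ℂ →L[ℂ] ℂ) (C : ℂ × ℂ →L[ℂ] ℂ × ℂ) :
    covectorWedge (α.comp C) (β.comp C) = covectorWedge α β *
      ((C (1, 0)).1 * (C (0, 1)).2 - (C (1, 0)).2 * (C (0, 1)).1) := by
  simp only [covectorWedge, ContinuousLinearMap.comp_apply]
  rw [covector_apply α (C (1, 0)), covector_apply α (C (0, 1)), covector_apply β (C (1, 0)),
    covector_apply β (C (0, 1))]
  ring

/-- Cramer's relation between three vectors of a plane. It builds the pencil from three foliations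
and later compares three of its members. -/
theorem covectorWedge_cyclic (α β γ : ℂ × ℂ →L[ℂ] ℂ) :
    covectorWedge β γ • α + covectorWedge γ α • β + covectorWedge α β • γ = 0 := by
  apply covector_ext <;> simp [covectorWedge] <;> ring

theorem eq_zero_of_smul_add_smul_eq_zero {α β : ℂ × ℂ →L[ℂ] ℂ} (h : covectorWedge α β ≠ 0)
    {s t : ℂ} (hst : s • α + t • β = 0) : s = 0 ∧ t = 0 := by
  have h1 := DFunLike.congr_fun hst (1, 0)
  have h2 := DFunLike.congr_fun hst (0, 1)
  simp at h1 h2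
  constructor
  · refine (mul_eq_zero.1 (?_ : s * covectorWedge α β = 0)).resolve_right h
    rw [covectorWedge]
    linear_combination β (0, 1) * h1 - β (1, 0) * h2
  · refine (mul_eq_zero.1 (?_ : t * covectorWedge α β = 0)).resolve_right h
    rw [covectorWedge]
    linear_combination α (1, 0) * h2 - α (0, 1) * h1

theorem isInvertible_of_det_ne_zero (C : ℂ × ℂ →L[ℂ] ℂ × ℂ)
    (h : (C (1, 0)).1 * (C (0, 1)).2 - (C (1, 0)).2 * (C (0, 1)).1 ≠ 0) : C.IsInvertible := by
  have hinj : Function.Injective (C : ℂ × ℂ →ₗ[ℂ] ℂ × ℂ) := by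
    rw [injective_iff_map_eq_zero]
    intro v hv
    have h1 := covector_apply ((ContinuousLinearMap.fst ℂ ℂ ℂ).comp C) v
    have h2 := covector_apply ((ContinuousLinearMap.snd ℂ ℂ ℂ).comp C) v
    have hv' : C v = 0 := hv
    simp only [ContinuousLinearMap.comp_apply, hv', map_zero, ContinuousLinearMap.coe_fst',
      ContinuousLinearMap.coe_snd'] at h1 h2
    ext
    · refine (mul_eq_zero.1 (?_ : v.1 * _ = 0)).resolve_right h
      linear_combination (C (0, 1)).1 * h2 - (C (0, 1)).2 * h1
    · refine (mul_eq_zero.1 (?_ : v.2 * _ = 0)).resolve_right h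
      linear_combination (C (1, 0)).2 * h1 - (C (1, 0)).1 * h2
  refine ⟨(LinearEquiv.ofInjectiveEndo _ hinj).toContinuousLinearEquiv, ?_⟩
  ext <;> rfl

/-! ### Pencils and cross-ratios -/

@[simp]
theorem Pencil.member_coe_apply (P : Pencil) (s : ℂ) (z v : ℂ × ℂ) :
    P.member (s : OnePoint ℂ) z v = P.ωzero z v - s * P.ωinfty z v := rfl

theorem Pencil.member_infty (P : Pencil) : P.member OnePoint.infty = P.ωinfty := rfl

/-- Homogeneous coordinates `(a : b)` treat `t = ∞` like any other parameter. -/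
theorem Pencil.exists_member_eq (P : Pencil) (t : OnePoint ℂ) :
    ∃ a b : ℂ, ∀ z, P.member t z = a • P.ωzero z + b • P.ωinfty z := by
  induction t using OnePoint.rec with
  | infty => exact ⟨0, 1, fun z => by ext1 <;> ext <;> simp [Pencil.member_infty]⟩
  | coe s => exact ⟨1, -s, fun z => by ext1 <;> ext <;> simp [sub_eq_add_neg]⟩

theorem OneForm.SameKernel.eventually_eq_smul {ω η : OneForm} (h : ω.SameKernel η) :
    ∀ᶠ z in 𝓝 (0 : ℂ × ℂ), ∃ u : ℂ, u ≠ 0 ∧ ω z = u • η z :=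
  h.mono fun _ hz => exists_eq_smul_of_same_kernel hz

theorem OneForm.sameKernel_of_eventually_smul_eq {ω η : OneForm} {u v : ℂ × ℂ → ℂ}
    (h : ∀ᶠ z in 𝓝 (0 : ℂ × ℂ), u z ≠ 0 ∧ v z ≠ 0 ∧ u z • ω z = v z • η z) :
    ω.SameKernel η := by
  filter_upwards [h] with z hz w
  obtain ⟨hu, hv, hz⟩ := hz
  have h1 : u z * ω z w = v z * η z w := by simpa using DFunLike.congr_fun hz w
  constructor
  · intro h0
    rw [h0, mul_zero] at h1
    exact (mul_eq_zero.1 h1.symm).resolve_left hv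
  · intro h0
    rw [h0, mul_zero] at h1
    exact (mul_eq_zero.1 h1).resolve_left hu

theorem analyticAt_covector_apply {ω : OneForm} {z : ℂ × ℂ} (h : AnalyticAt ℂ ω z) (v : ℂ × ℂ) :
    AnalyticAt ℂ (fun w => ω w v) z :=
  ((ContinuousLinearMap.apply ℂ ℂ v).analyticAt _).comp h

theorem OneForm.analyticAt_coeffX {ω : OneForm} {z : ℂ × ℂ} (h : AnalyticAt ℂ ω z) :
    AnalyticAt ℂ ω.coeffX z := analyticAt_covector_apply h _

theorem OneForm.analyticAt_coeffY {ω : OneForm} {z : ℂ × ℂ} (h : AnalyticAt ℂ ω z) :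
    AnalyticAt ℂ ω.coeffY z := analyticAt_covector_apply h _

theorem OneForm.analyticAt_wedge {ω η : OneForm} {z : ℂ × ℂ} (hω : AnalyticAt ℂ ω z)
    (hη : AnalyticAt ℂ η z) : AnalyticAt ℂ (ω.wedge η) z :=
  ((analyticAt_coeffX hω).mul (analyticAt_coeffY hη)).sub
    ((analyticAt_coeffY hω).mul (analyticAt_coeffX hη))

theorem OneForm.eventually_wedge_ne_zero {ω η : OneForm} (hω : AnalyticAt ℂ ω 0)
    (hη : AnalyticAt ℂ η 0) (h : ω.wedge η 0 ≠ 0) : ∀ᶠ z in 𝓝 (0 : ℂ × ℂ), ω.wedge η z ≠ 0 :=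
  (analyticAt_wedge hω hη).continuousAt.eventually_ne h

namespace RegularWeb

variable {d : ℕ} {W : RegularWeb d} {P : Pencil}

theorem eventually_wedge_ne_zero (W : RegularWeb d) {i j : Fin d} (h : i ≠ j) :
    ∀ᶠ z in 𝓝 (0 : ℂ × ℂ), (W.foliation i).form.wedge (W.foliation j).form z ≠ 0 :=
  OneForm.eventually_wedge_ne_zero (W.foliation i).analyticAt (W.foliation j).analyticAt
    (W.transversal i j h)

theorem IsContainedIn.exists_coefficients (h : W.IsContainedIn P) :
    ∃ a b : Fin d → ℂ, ∀ᶠ z in 𝓝 (0 : ℂ × ℂ), ∀ i, ∃ u : ℂ, u ≠ 0 ∧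
      (W.foliation i).form z = u • (a i • P.ωzero z + b i • P.ωinfty z) := by
  choose t ht using h
  choose a b hab using fun i => P.exists_member_eq (t i)
  refine ⟨a, b, Filter.eventually_all.2 fun i => ?_⟩
  filter_upwards [(ht i).eventually_eq_smul] with z hz
  rwa [hab i z] at hz

/-- The wedge of members `i` and `j` is `uᵢ uⱼ Δᵢⱼ δ` with `Δᵢⱼ` constant; the factors `u` and `δ`
cancel in the cross-ratio. -/
theorem IsContainedIn.hasConstantCrossRatio (h : W.IsContainedIn P) :
    W.HasConstantCrossRatio := by
  obtain ⟨a, b, hab⟩ := h.exists_coefficients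
  intro σ
  let Δ : Fin 4 → Fin 4 → ℂ := fun i j => a (σ i) * b (σ j) - b (σ i) * a (σ j)
  refine ⟨(Δ 0 2 * Δ 1 3) / (Δ 1 2 * Δ 0 3), ?_⟩
  filter_upwards [hab, OneForm.eventually_wedge_ne_zero P.analyticAt_zero P.analyticAt_infty
    P.transversal] with z hz hδ
  choose u hu hz using hz
  have key : ∀ i j : Fin 4, (W.foliation (σ i)).form.wedge (W.foliation (σ j)).form z =
      u (σ i) * u (σ j) * (Δ i j * P.ωzero.wedge P.ωinfty z) := fun i j => by
    rw [OneForm.wedge_eq_covectorWedge, hz, hz, covectorWedge_smul_smul,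
      covectorWedge_combination, OneForm.wedge_eq_covectorWedge]
  rw [crossRatio, key, key, key, key]
  set δ := P.ωzero.wedge P.ωinfty z
  have hk : u (σ 0) * u (σ 1) * u (σ 2) * u (σ 3) * δ ^ 2 ≠ 0 := by
    simp [hu, hδ]
  rw [← mul_div_mul_left (Δ 0 2 * Δ 1 3) (Δ 1 2 * Δ 0 3) hk]
  congr 1 <;> ring

theorem HasConstantCrossRatio.exists_pencil (hd : 3 < d) (h : W.HasConstantCrossRatio) :
    ∃ P : Pencil, W.IsContainedIn P := by
  let i₀ : Fin d := ⟨0, by omega⟩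
  let i₁ : Fin d := ⟨1, by omega⟩
  let i₂ : Fin d := ⟨2, by omega⟩
  have h01 : i₀ ≠ i₁ := by simp [i₀, i₁]
  have h02 : i₀ ≠ i₂ := by simp [i₀, i₂]
  have h12 : i₁ ≠ i₂ := by simp [i₁, i₂]
  let ω : Fin d → OneForm := fun i => (W.foliation i).form
  have hω : ∀ i, AnalyticAt ℂ (ω i) 0 := fun i => (W.foliation i).analyticAt
  have hw : ∀ {i j}, i ≠ j → ∀ᶠ z in 𝓝 (0 : ℂ × ℂ), (ω i).wedge (ω j) z ≠ 0 := fun h =>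
    W.eventually_wedge_ne_zero h
  let P : Pencil :=
    { ωzero := fun z => (ω i₂).wedge (ω i₁) z • ω i₀ z
      ωinfty := fun z => (ω i₀).wedge (ω i₂) z • ω i₁ z
      analyticAt_zero := (OneForm.analyticAt_wedge (hω _) (hω _)).smul (hω _)
      analyticAt_infty := (OneForm.analyticAt_wedge (hω _) (hω _)).smul (hω _)
      transversal := by
        rw [OneForm.wedge_eq_covectorWedge, covectorWedge_smul_smul]
        exact mul_ne_zero (mul_ne_zero (W.transversal _ _ h12.symm) (W.transversal _ _ h02))
          (W.transversal _ _ h01) }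
  refine ⟨P, fun i => ?_⟩
  by_cases hi0 : i = i₀
  · refine ⟨((0 : ℂ) : OnePoint ℂ), OneForm.sameKernel_of_eventually_smul_eq
      (u := (ω i₂).wedge (ω i₁)) (v := 1) ?_⟩
    filter_upwards [hw h12.symm] with z hz
    exact ⟨hz, one_ne_zero, by ext1 <;> ext <;> simp [P, hi0, ω]⟩
  by_cases hi1 : i = i₁
  · refine ⟨OnePoint.infty, OneForm.sameKernel_of_eventually_smul_eq
      (u := (ω i₀).wedge (ω i₂)) (v := 1) ?_⟩
    filter_upwards [hw h02] with z hz
    exact ⟨hz, one_ne_zero, by simp [Pencil.member_infty, P, hi1, ω]⟩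
  by_cases hi2 : i = i₂
  -- The weights in `P` come from the cyclic relation, which reads `ω₀ + ω_∞ = (ω i₀ ∧ ω i₁) • ω
  -- i₂`.
  · refine ⟨((-1 : ℂ) : OnePoint ℂ), OneForm.sameKernel_of_eventually_smul_eq
      (u := (ω i₀).wedge (ω i₁)) (v := 1) ?_⟩
    filter_upwards [hw h01] with z hz
    refine ⟨hz, one_ne_zero, ?_⟩
    subst hi2
    apply covector_ext <;> simp [P, OneForm.wedge, OneForm.coeffX, OneForm.coeffY, ω]
      <;> ring
  have hinj : Function.Injective ![i₀, i₁, i₂, i] := by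
    intro a b hab
    fin_cases a <;> fin_cases b <;>
      simp_all [Ne.symm hi0, Ne.symm hi1, Ne.symm hi2, h01.symm, h02.symm, h12.symm]
  obtain ⟨c, hc⟩ := h ⟨_, hinj⟩
  -- The cyclic relation for `i₀, i₁, i` expresses `ω i` through `ω i₀` and `ω i₁`; the cross-ratio
  -- `c` turns the coefficients into those of `ω₀ + c⁻¹ ω_∞`, up to a common factor.
  refine ⟨((-c⁻¹ : ℂ) : OnePoint ℂ), OneForm.sameKernel_of_eventually_smul_eq
    (u := fun z => (ω i₀).wedge (ω i₁) z * (ω i₀).wedge (ω i₂) z)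
    (v := fun z => c * (ω i₀).wedge (ω i) z) ?_⟩
  filter_upwards [hc, hw h01, hw h02, hw h12, hw (Ne.symm hi0), hw (Ne.symm hi1)]
    with z hcz h01 h02 h12 h0i h1i
  have hcz : (ω i₀).wedge (ω i₂) z * (ω i₁).wedge (ω i) z /
      ((ω i₁).wedge (ω i₂) z * (ω i₀).wedge (ω i) z) = c := hcz
  have hc0 : c ≠ 0 := by
    rw [← hcz]
    exact div_ne_zero (mul_ne_zero h02 h1i) (mul_ne_zero h12 h0i)
  refine ⟨mul_ne_zero h01 h02, mul_ne_zero hc0 h0i, ?_⟩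
  have hrel : (ω i₀).wedge (ω i₂) z * (ω i₁).wedge (ω i) z =
      c * ((ω i₁).wedge (ω i₂) z * (ω i₀).wedge (ω i) z) := by
    rw [← hcz, div_mul_cancel₀ _ (mul_ne_zero h12 h0i)]
  have hcyc := covectorWedge_cyclic (ω i₀ z) (ω i₁ z) (ω i z)
  simp only [← OneForm.wedge_eq_covectorWedge] at hcyc
  have hanti : (ω i₂).wedge (ω i₁) z = -(ω i₁).wedge (ω i₂) z := by
    simp only [OneForm.wedge]; ring
  have hanti' : (ω i).wedge (ω i₀) z = -(ω i₀).wedge (ω i) z := by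
    simp only [OneForm.wedge]; ring
  rw [hanti'] at hcyc
  refine ContinuousLinearMap.ext fun v => ?_
  have hv := DFunLike.congr_fun hcyc v
  simp only [add_apply, smul_apply, smul_eq_mul, zero_apply] at hv
  simp only [smul_apply, smul_eq_mul, Pencil.member_coe_apply, P, hanti]
  change _ * ω i z v = _
  field_simp
  linear_combination (ω i₀).wedge (ω i₂) z * hv - ω i₀ z v * hrel

theorem IsParallelizable.isHexagonal (h : W.IsParallelizable) : W.IsHexagonal := by
  obtain ⟨φ, hφ, c, hc⟩ := h
  exact fun σ => ⟨φ, hφ, fun i => c (σ i), fun i => hc (σ i)⟩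

end RegularWeb

end PlaneWeb

/-! ### Stability of closedness; exact and logarithmic forms -/

section Closed

variable {E F : Type*} [NormedAddCommGroup E] [NormedSpace ℂ E] [NormedAddCommGroup F]
  [NormedSpace ℂ F]

theorem IsClosedNearZero.congr {ω η : E → E →L[ℂ] F} (hω : IsClosedNearZero ω)
    (h : ω =ᶠ[𝓝 0] η) : IsClosedNearZero η := by
  filter_upwards [hω, h.fderiv (𝕜 := ℂ)] with z hz hz'
  rwa [← hz']

theorem IsClosedNearZero.linear_combination {ω η : E → E →L[ℂ] F} (hω : IsClosedNearZero ω)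
    (hη : IsClosedNearZero η) (hω' : ∀ᶠ z in 𝓝 (0 : E), DifferentiableAt ℂ ω z)
    (hη' : ∀ᶠ z in 𝓝 (0 : E), DifferentiableAt ℂ η z) (a b : ℂ) :
    IsClosedNearZero fun z => a • ω z + b • η z := by
  filter_upwards [hω, hη, hω', hη'] with z h1 h2 h3 h4 u v
  have h : HasFDerivAt (fun z => a • ω z + b • η z) (a • fderiv ℂ ω z + b • fderiv ℂ η z) z :=
    (h3.hasFDerivAt.const_smul a).add (h4.hasFDerivAt.const_smul b)
  rw [h.fderiv]
  simp [h1 u v, h2 u v]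

theorem AnalyticAt.eventually_differentiableAt [CompleteSpace F] {f : E → F}
    (h : AnalyticAt ℂ f 0) : ∀ᶠ z in 𝓝 (0 : E), DifferentiableAt ℂ f z :=
  h.eventually_analyticAt.mono fun _ hz => hz.differentiableAt

theorem isClosedNearZero_fderiv [CompleteSpace F] {f : E → F} (h : AnalyticAt ℂ f 0) :
    IsClosedNearZero (fderiv ℂ f) := by
  filter_upwards [h.eventually_analyticAt] with z hz u v
  exact (ContDiffAt.isSymmSndFDerivAt_of_omega hz.contDiffAt) u v

/-- The derivative is `f⁻¹ D²f - f⁻² df ⊗ df`, a sum of symmetric terms. -/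
theorem isClosedNearZero_logDeriv {f : E → ℂ} (h : AnalyticAt ℂ f 0) (h0 : f 0 ≠ 0) :
    IsClosedNearZero fun z => (f z)⁻¹ • fderiv ℂ f z := by
  filter_upwards [h.eventually_analyticAt, h.continuousAt.eventually_ne h0,
    isClosedNearZero_fderiv h] with z hz hz0 hs u v
  have h1 : HasFDerivAt (fun z => (f z)⁻¹) (-(f z ^ 2)⁻¹ • fderiv ℂ f z) z :=
    (hasDerivAt_inv hz0).comp_hasFDerivAt z hz.differentiableAt.hasFDerivAt
  have h2 : HasFDerivAt (fun z => (f z)⁻¹ • fderiv ℂ f z) _ z :=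
    h1.smul hz.fderiv.differentiableAt.hasFDerivAt
  rw [h2.fderiv]
  simp [hs u v]
  ring

end Closed

namespace PlaneWeb

/-! ### Exterior derivative and symmetry of the derivative -/

namespace OneForm

theorem hasFDerivAt_apply {ω : OneForm} {z : ℂ × ℂ} (h : DifferentiableAt ℂ ω z) (v : ℂ × ℂ) :
    HasFDerivAt (fun w => ω w v) ((fderiv ℂ ω z).flip v) z :=
  (ContinuousLinearMap.apply ℂ ℂ v).hasFDerivAt.comp z h.hasFDerivAt

theorem fderiv_coeffX {ω : OneForm} {z : ℂ × ℂ} (h : DifferentiableAt ℂ ω z) (u : ℂ × ℂ) :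
    fderiv ℂ ω.coeffX z u = fderiv ℂ ω z u (1, 0) := by
  have := (hasFDerivAt_apply h (1, 0)).fderiv
  exact DFunLike.congr_fun this u

theorem fderiv_coeffY {ω : OneForm} {z : ℂ × ℂ} (h : DifferentiableAt ℂ ω z) (u : ℂ × ℂ) :
    fderiv ℂ ω.coeffY z u = fderiv ℂ ω z u (0, 1) := by
  have := (hasFDerivAt_apply h (0, 1)).fderiv
  exact DFunLike.congr_fun this u

theorem fderiv_symmetric_iff {ω : OneForm} {z : ℂ × ℂ} (h : DifferentiableAt ℂ ω z) :
    (∀ u v, fderiv ℂ ω z u v = fderiv ℂ ω z v u) ↔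
      fderiv ℂ ω.coeffY z (1, 0) = fderiv ℂ ω.coeffX z (0, 1) := by
  rw [fderiv_coeffX h, fderiv_coeffY h]
  refine ⟨fun h => h _ _, fun hs u v => ?_⟩
  have key : ∀ u v : ℂ × ℂ, fderiv ℂ ω z u v =
      v.1 * (u.1 * fderiv ℂ ω z (1, 0) (1, 0) + u.2 * fderiv ℂ ω z (0, 1) (1, 0)) +
      v.2 * (u.1 * fderiv ℂ ω z (1, 0) (0, 1) + u.2 * fderiv ℂ ω z (0, 1) (0, 1)) := by
    intro u v
    rw [covector_apply (fderiv ℂ ω z u) v]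
    congr 2
    · exact covector_apply ((fderiv ℂ ω z).flip (1, 0)) u
    · exact covector_apply ((fderiv ℂ ω z).flip (0, 1)) u
  rw [key u v, key v u, hs]
  ring

theorem d_eq_zero_iff {ω : OneForm} {z : ℂ × ℂ} (h : DifferentiableAt ℂ ω z) :
    ω.d z = 0 ↔ ∀ u v, fderiv ℂ ω z u v = fderiv ℂ ω z v u := by
  have hdiff : DifferentiableAt ℂ (fun z => ContinuousAlternatingMap.ofSubsingleton ℂ (ℂ × ℂ) ℂ
      (0 : Fin 1) (ω z)) z :=
    (ContinuousAlternatingMap.ofSubsingletonLIE (𝕜 := ℂ) (E := ℂ × ℂ) (F := ℂ)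
      (0 : Fin 1)).differentiableAt.comp
      z h
  have key : ∀ m : Fin 2 → ℂ × ℂ,
      ω.d z m = fderiv ℂ ω z (m 0) (m 1) - fderiv ℂ ω z (m 1) (m 0) := by
    intro m
    rw [OneForm.d, extDeriv_apply hdiff]
    simp only [ContinuousAlternatingMap.ofSubsingleton_apply_apply,
      (hasFDerivAt_apply h _).fderiv]
    refine (Fin.sum_univ_two _).trans ?_
    simp [Fin.removeNth, sub_eq_add_neg]
  constructor
  · intro h0 u v
    have := key ![u, v]
    rw [h0] at this
    exact (sub_eq_zero.1 this.symm)
  · intro hs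
    ext m
    rw [key, hs, sub_self]
    rfl

theorem eventually_d_eq_zero_iff {ω : OneForm} (h : AnalyticAt ℂ ω 0) :
    (∀ᶠ z in 𝓝 (0 : ℂ × ℂ), ω.d z = 0) ↔ IsClosedNearZero ω :=
  Filter.eventually_congr <| h.eventually_differentiableAt.mono fun _ hz => d_eq_zero_iff hz

end OneForm

/-! ### The form `κ` of a pencil -/

namespace Pencil

variable (P : Pencil)

/-- The logarithmic derivative of `δ = ω₀ ∧ ω_∞`. -/
noncomputable def logDerivWedge : OneForm := fun z =>
  (P.ωzero.wedge P.ωinfty z)⁻¹ • fderiv ℂ (P.ωzero.wedge P.ωinfty) z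

/-- The common `1`-form `η` with `dω₀ = η ∧ ω₀` and `dω_∞ = η ∧ ω_∞`. -/
noncomputable def commonFactor : OneForm := fun z =>
  (-1 / 2 : ℂ) • P.riccati.kappa z + (1 / 2 : ℂ) • P.logDerivWedge z

theorem analyticAt_wedge : AnalyticAt ℂ (P.ωzero.wedge P.ωinfty) 0 :=
  OneForm.analyticAt_wedge P.analyticAt_zero P.analyticAt_infty

theorem analyticAt_logDerivWedge : AnalyticAt ℂ P.logDerivWedge 0 :=
  (P.analyticAt_wedge.inv P.transversal).smul P.analyticAt_wedge.fderiv

theorem isClosedNearZero_logDerivWedge : IsClosedNearZero P.logDerivWedge :=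
  isClosedNearZero_logDeriv P.analyticAt_wedge P.transversal

theorem analyticAt_kappa : AnalyticAt ℂ P.riccati.kappa 0 := by
  have hf₀ := OneForm.analyticAt_coeffX P.analyticAt_zero
  have hg₀ := OneForm.analyticAt_coeffY P.analyticAt_zero
  have hf₁ := OneForm.analyticAt_coeffX P.analyticAt_infty
  have hg₁ := OneForm.analyticAt_coeffY P.analyticAt_infty
  have hδ := P.analyticAt_wedge.inv P.transversal
  have hα : AnalyticAt ℂ P.riccati.α 0 :=
    hδ.smul ((hg₀.smul hg₁.fderiv).sub (hg₁.smul hg₀.fderiv))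
  have hβ : AnalyticAt ℂ P.riccati.β 0 :=
    hδ.smul ((((hf₀.smul hg₁.fderiv).sub (hg₁.smul hf₀.fderiv)).add
      (hg₀.smul hf₁.fderiv)).sub (hf₁.smul hg₀.fderiv))
  have hγ : AnalyticAt ℂ P.riccati.γ 0 :=
    hδ.smul ((hf₀.smul hf₁.fderiv).sub (hf₁.smul hf₀.fderiv))
  exact (((analyticAt_const.mul (OneForm.analyticAt_coeffY hγ)).sub
    (OneForm.analyticAt_coeffX hβ)).smul analyticAt_const).add
    (((OneForm.analyticAt_coeffY hβ).sub
      (analyticAt_const.mul (OneForm.analyticAt_coeffX hα))).smul analyticAt_const)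

theorem analyticAt_commonFactor : AnalyticAt ℂ P.commonFactor 0 :=
  (P.analyticAt_kappa.const_smul (c := (-1 / 2 : ℂ))).add
    (P.analyticAt_logDerivWedge.const_smul (c := (1 / 2 : ℂ)))

theorem isTorsionFree_iff : P.IsTorsionFree ↔ IsClosedNearZero P.riccati.kappa :=
  OneForm.eventually_d_eq_zero_iff P.analyticAt_kappa

/-- `commonFactor` and `-κ / 2` differ by half of the closed form `d log δ`. -/
theorem isTorsionFree_iff_commonFactor : P.IsTorsionFree ↔ IsClosedNearZero P.commonFactor := by
  rw [isTorsionFree_iff]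
  have hl := P.isClosedNearZero_logDerivWedge
  have hl' := P.analyticAt_logDerivWedge.eventually_differentiableAt
  constructor
  · intro h
    exact h.linear_combination hl P.analyticAt_kappa.eventually_differentiableAt hl' _ _
  · intro h
    -- Solving the definition of `η` for `κ` gives `κ = -2 η + d log δ`.
    refine (h.linear_combination hl P.analyticAt_commonFactor.eventually_differentiableAt hl'
      (-2) 1).congr (Filter.Eventually.of_forall fun z => ?_)
    apply covector_ext <;> simp [commonFactor] <;> ring

variable {P}

theorem fderiv_wedge {ω η : OneForm} {z : ℂ × ℂ} (hω : DifferentiableAt ℂ ω z)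
    (hη : DifferentiableAt ℂ η z) (u : ℂ × ℂ) : fderiv ℂ (ω.wedge η) z u =
      ω.coeffX z * fderiv ℂ η.coeffY z u + η.coeffY z * fderiv ℂ ω.coeffX z u -
      (ω.coeffY z * fderiv ℂ η.coeffX z u + η.coeffX z * fderiv ℂ ω.coeffY z u) := by
  have h1 : ∀ {θ : OneForm} {v : ℂ × ℂ}, DifferentiableAt ℂ θ z →
      DifferentiableAt ℂ (fun w => θ w v) z :=
    fun h => (OneForm.hasFDerivAt_apply h _).differentiableAt
  have hX : ∀ {θ : OneForm}, DifferentiableAt ℂ θ z → HasFDerivAt θ.coeffX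
    (fderiv ℂ θ.coeffX z) z := fun h => (h1 h).hasFDerivAt
  have hY : ∀ {θ : OneForm}, DifferentiableAt ℂ θ z → HasFDerivAt θ.coeffY
    (fderiv ℂ θ.coeffY z) z := fun h => (h1 h).hasFDerivAt
  have h := ((hX hω).mul (hY hη)).sub ((hY hω).mul (hX hη))
  have h' : HasFDerivAt (ω.wedge η) _ z := h
  rw [h'.fderiv]
  simp

/-- Cramer's rule for the linear system `dω₀ = η ∧ ω₀`, `dω_∞ = η ∧ ω_∞`, whose determinant is `δ`
up to sign. This formula and its `dy` counterpart are where the explicit `κ` enters. -/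
theorem commonFactor_apply_fst {z : ℂ × ℂ} (h₀ : DifferentiableAt ℂ P.ωzero z)
    (h₁ : DifferentiableAt ℂ P.ωinfty z) (hδ : P.ωzero.wedge P.ωinfty z ≠ 0) :
    P.commonFactor z (1, 0) * P.ωzero.wedge P.ωinfty z =
      P.ωzero.coeffX z *
        (fderiv ℂ P.ωinfty.coeffY z (1, 0) - fderiv ℂ P.ωinfty.coeffX z (0, 1)) -
      P.ωinfty.coeffX z *
        (fderiv ℂ P.ωzero.coeffY z (1, 0) - fderiv ℂ P.ωzero.coeffX z (0, 1)) := by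
  simp only [commonFactor, logDerivWedge, RiccatiForm.kappa, riccati, add_apply, smul_apply,
    smul_eq_mul, fderiv_wedge h₀ h₁, OneForm.coeffX, OneForm.coeffY, sub_apply,
    ContinuousLinearMap.coe_fst', ContinuousLinearMap.coe_snd']
  field_simp
  ring

theorem commonFactor_apply_snd {z : ℂ × ℂ} (h₀ : DifferentiableAt ℂ P.ωzero z)
    (h₁ : DifferentiableAt ℂ P.ωinfty z) (hδ : P.ωzero.wedge P.ωinfty z ≠ 0) :
    P.commonFactor z (0, 1) * P.ωzero.wedge P.ωinfty z =
      P.ωzero.coeffY z *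
        (fderiv ℂ P.ωinfty.coeffY z (1, 0) - fderiv ℂ P.ωinfty.coeffX z (0, 1)) -
      P.ωinfty.coeffY z *
        (fderiv ℂ P.ωzero.coeffY z (1, 0) - fderiv ℂ P.ωzero.coeffX z (0, 1)) := by
  simp only [commonFactor, logDerivWedge, RiccatiForm.kappa, riccati, add_apply, smul_apply,
    smul_eq_mul, fderiv_wedge h₀ h₁, OneForm.coeffX, OneForm.coeffY, sub_apply,
    ContinuousLinearMap.coe_fst', ContinuousLinearMap.coe_snd']
  field_simp
  ring

end Pencil

end PlaneWeb

namespace PlaneWeb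

/-! ### Torsion-free pencils are parallelizable -/

namespace Pencil

variable {P : Pencil}

/-- A common integrating factor of `ω₀` and `ω_∞` makes both forms closed. -/
theorem isClosedNearZero_smul {ω η : OneForm} {h : ℂ × ℂ → ℂ} (hω : AnalyticAt ℂ ω 0)
    (hh : ∀ᶠ z in 𝓝 (0 : ℂ × ℂ), HasFDerivAt h (-(h z) • η z) z)
    (hη : ∀ᶠ z in 𝓝 (0 : ℂ × ℂ), fderiv ℂ ω.coeffY z (1, 0) - fderiv ℂ ω.coeffX z (0, 1) =
      η z (1, 0) * ω.coeffY z - η z (0, 1) * ω.coeffX z) :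
    IsClosedNearZero fun z => h z • ω z := by
  filter_upwards [hh, hη, hω.eventually_differentiableAt] with z h1 h2 h3
  have hd : HasFDerivAt (fun z => h z • ω z)
      (h z • fderiv ℂ ω z + (-(h z) • η z).smulRight (ω z)) z := h1.smul h3.hasFDerivAt
  rw [OneForm.fderiv_symmetric_iff hd.differentiableAt,
    OneForm.fderiv_coeffX hd.differentiableAt, OneForm.fderiv_coeffY hd.differentiableAt, hd.fderiv]
  rw [OneForm.fderiv_coeffX h3, OneForm.fderiv_coeffY h3] at h2
  simp only [add_apply, smul_apply, smul_eq_mul, ContinuousLinearMap.smulRight_apply]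
  simp only [OneForm.coeffX, OneForm.coeffY] at h2
  -- Here `d(hω) = dh ∧ ω + h dω = -h η ∧ ω + h η ∧ ω = 0`.
  linear_combination h z * h2

/-- After multiplication by `δ`, the two Cramer formulas are substituted back into the system. -/
theorem curl_zero_eq {z : ℂ × ℂ} (h₀ : DifferentiableAt ℂ P.ωzero z)
    (h₁ : DifferentiableAt ℂ P.ωinfty z) (hδ : P.ωzero.wedge P.ωinfty z ≠ 0) :
    fderiv ℂ P.ωzero.coeffY z (1, 0) - fderiv ℂ P.ωzero.coeffX z (0, 1) =
      P.commonFactor z (1, 0) * P.ωzero.coeffY z - P.commonFactor z (0, 1) * P.ωzero.coeffX z := by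
  refine mul_right_cancel₀ hδ ?_
  rw [sub_mul (_ * _), mul_right_comm, commonFactor_apply_fst h₀ h₁ hδ,
    mul_right_comm (P.commonFactor z (0, 1)), commonFactor_apply_snd h₀ h₁ hδ, OneForm.wedge]
  ring

theorem curl_infty_eq {z : ℂ × ℂ} (h₀ : DifferentiableAt ℂ P.ωzero z)
    (h₁ : DifferentiableAt ℂ P.ωinfty z) (hδ : P.ωzero.wedge P.ωinfty z ≠ 0) :
    fderiv ℂ P.ωinfty.coeffY z (1, 0) - fderiv ℂ P.ωinfty.coeffX z (0, 1) =
      P.commonFactor z (1, 0) * P.ωinfty.coeffY z -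
        P.commonFactor z (0, 1) * P.ωinfty.coeffX z := by
  refine mul_right_cancel₀ hδ ?_
  rw [sub_mul (_ * _), mul_right_comm, commonFactor_apply_fst h₀ h₁ hδ,
    mul_right_comm (P.commonFactor z (0, 1)), commonFactor_apply_snd h₀ h₁ hδ, OneForm.wedge]
  ring

/-- In suitable coordinates `(x, y)`, a torsion-free pencil is the pencil of `dx` and `dy`. -/
theorem IsTorsionFree.exists_coordinateChange (hP : P.IsTorsionFree) :
    ∃ φ : ℂ × ℂ → ℂ × ℂ, IsCoordinateChange φ ∧ ∃ h : ℂ × ℂ → ℂ,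
      ∀ᶠ z in 𝓝 (0 : ℂ × ℂ), h z ≠ 0 ∧
        fderiv ℂ φ z = (h z • P.ωzero z).prod (h z • P.ωinfty z) := by
  obtain ⟨g, hg, hg'⟩ := (P.isTorsionFree_iff_commonFactor.1 hP).exists_primitive
    P.analyticAt_commonFactor
  let h : ℂ × ℂ → ℂ := fun z => Complex.exp (-g z)
  have hh : AnalyticAt ℂ h 0 := hg.neg.cexp
  have hh' : ∀ᶠ z in 𝓝 (0 : ℂ × ℂ), HasFDerivAt h (-(h z) • P.commonFactor z) z := by
    filter_upwards [hg'] with z hz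
    have h1 : HasFDerivAt h (Complex.exp (-g z) • -P.commonFactor z) z := hz.neg.cexp
    rwa [smul_neg, ← neg_smul] at h1
  have hne : ∀ z, h z ≠ 0 := fun z => Complex.exp_ne_zero _
  have hgood : ∀ᶠ z in 𝓝 (0 : ℂ × ℂ), DifferentiableAt ℂ P.ωzero z ∧
      DifferentiableAt ℂ P.ωinfty z ∧ P.ωzero.wedge P.ωinfty z ≠ 0 :=
    P.analyticAt_zero.eventually_differentiableAt.and
      (P.analyticAt_infty.eventually_differentiableAt.and
        (OneForm.eventually_wedge_ne_zero P.analyticAt_zero P.analyticAt_infty P.transversal))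
  obtain ⟨x, hx, hx'⟩ := (isClosedNearZero_smul P.analyticAt_zero hh'
    (hgood.mono fun z hz => curl_zero_eq hz.1 hz.2.1 hz.2.2)).exists_primitive
    (hh.smul P.analyticAt_zero)
  obtain ⟨y, hy, hy'⟩ := (isClosedNearZero_smul P.analyticAt_infty hh'
    (hgood.mono fun z hz => curl_infty_eq hz.1 hz.2.1 hz.2.2)).exists_primitive
    (hh.smul P.analyticAt_infty)
  let φ : ℂ × ℂ → ℂ × ℂ := fun z => (x z - x 0, y z - y 0)
  have hφ : ∀ᶠ z in 𝓝 (0 : ℂ × ℂ),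
      fderiv ℂ φ z = (h z • P.ωzero z).prod (h z • P.ωinfty z) := by
    filter_upwards [hx', hy'] with z h1 h2
    exact ((h1.sub_const _).prodMk (h2.sub_const _)).fderiv
  refine ⟨φ, ⟨(hx.sub analyticAt_const).prod (hy.sub analyticAt_const), by simp [φ], ?_⟩, h,
    hφ.mono fun z hz => ⟨hne z, hz⟩⟩
  apply isInvertible_of_det_ne_zero
  rw [hφ.self_of_nhds]
  -- The Jacobian determinant of `φ` at the origin is `h(0)² δ(0)`.
  have := mul_ne_zero (mul_ne_zero (hne 0) (hne 0)) P.transversal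
  rw [OneForm.wedge_eq_covectorWedge, ← covectorWedge_smul_smul, covectorWedge] at this
  intro h0
  refine this (Eq.trans ?_ h0)
  simp only [ContinuousLinearMap.prod_apply]
  ring

end Pencil

/-- Since `dφ = (h ω₀, h ω_∞)`, the member with coordinates `(a : b)` is the kernel of the pull-back
of `a dx + b dy`. -/
theorem RegularWeb.IsContainedIn.isParallelizable {d : ℕ} {W : RegularWeb d} {P : Pencil}
    (hW : W.IsContainedIn P) (hP : P.IsTorsionFree) : W.IsParallelizable := by
  obtain ⟨φ, hφ, h, hh⟩ := hP.exists_coordinateChange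
  obtain ⟨a, b, hab⟩ := hW.exists_coefficients
  refine ⟨φ, hφ, fun i => a i • ContinuousLinearMap.fst ℂ ℂ ℂ + b i • ContinuousLinearMap.snd ℂ ℂ ℂ,
    fun i => ?_⟩
  filter_upwards [hh, hab] with z hz hz' v
  obtain ⟨u, hu, hz'⟩ := hz' i
  rw [hz', hz.2]
  have h1 : (a i * (h z * P.ωzero z v) + b i * (h z * P.ωinfty z v)) =
      h z * (a i * P.ωzero z v + b i * P.ωinfty z v) := by ring
  simp [h1, hz.1, ← mul_add, hu]

/-! ### Hexagonal webs are contained in torsion-free pencils only -/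

/-- The projective map sending the three points `(aᵢ : bᵢ)` to the `cᵢ` is unique. The order of
quantifiers matters: `D₀` and `D₁` depend on the constants only, so they serve at all points `z` at
once, where `α`, `β`, `C` and `u` vary. -/
theorem exists_common_multiple {a b : Fin 3 → ℂ} {c : Fin 3 → (ℂ × ℂ →L[ℂ] ℂ)}
    (hΔ : ∀ i j, i ≠ j → a i * b j - b i * a j ≠ 0)
    (hΓ : ∀ i j, i ≠ j → covectorWedge (c i) (c j) ≠ 0) :
    ∃ D₀ D₁ : ℂ × ℂ →L[ℂ] ℂ, ∀ (α β : ℂ × ℂ →L[ℂ] ℂ) (C : ℂ × ℂ →L[ℂ] ℂ × ℂ) (u : Fin 3 → ℂ),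
      covectorWedge ((c 0).comp C) ((c 1).comp C) ≠ 0 →
      (∀ i, a i • α + b i • β = u i • (c i).comp C) →
      ∃ μ : ℂ, α = μ • D₀.comp C ∧ β = μ • D₁.comp C := by
  have h01 := hΔ 0 1 (by decide)
  have h12 := hΔ 1 2 (by decide)
  have h20 := hΔ 2 0 (by decide)
  have g01 := hΓ 0 1 (by decide)
  set Δ01 := a 0 * b 1 - b 0 * a 1 with hΔ01
  set Δ12 := a 1 * b 2 - b 1 * a 2 with hΔ12
  set Δ20 := a 2 * b 0 - b 2 * a 0 with hΔ20
  set Γ01 := covectorWedge (c 0) (c 1) with hΓ01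
  set Γ12 := covectorWedge (c 1) (c 2) with hΓ12
  set Γ20 := covectorWedge (c 2) (c 0) with hΓ20
  -- The vectors `uᵢ cᵢ` satisfy the cyclic relation with coefficients `Δ`, the `cᵢ` the one with
  -- coefficients `Γ`. Proportionality gives `u 0 = μ Γ12 / Δ12` and `u 1 = μ Γ20 / Δ20`; solving
  -- for `α` and `β` and dropping `μ` yields the witnesses.
  refine ⟨Δ01⁻¹ • ((b 1 * Γ12 / Δ12) • c 0 - (b 0 * Γ20 / Δ20) • c 1),
    Δ01⁻¹ • ((a 0 * Γ20 / Δ20) • c 1 - (a 1 * Γ12 / Δ12) • c 0), fun α β C u hC h => ?_⟩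
  have hcyc : ∀ v, Γ12 * c 0 (C v) + Γ20 * c 1 (C v) + Γ01 * c 2 (C v) = 0 := fun v => by
    simpa using DFunLike.congr_fun (covectorWedge_cyclic (c 0) (c 1) (c 2)) (C v)
  have hv : ∀ i v, a i * α v + b i * β v = u i * c i (C v) := fun i v => by
    simpa using DFunLike.congr_fun (h i) v
  have hrel : (Γ01 * Δ12 * u 0 - Δ01 * u 2 * Γ12) • (c 0).comp C +
      (Γ01 * Δ20 * u 1 - Δ01 * u 2 * Γ20) • (c 1).comp C = 0 := by
    refine ContinuousLinearMap.ext fun v => ?_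
    simp only [add_apply, smul_apply, smul_eq_mul, ContinuousLinearMap.comp_apply, zero_apply]
    have e0 := hv 0 v
    have e1 := hv 1 v
    have e2 := hv 2 v
    have e3 := hcyc v
    rw [hΔ01, hΔ12, hΔ20] at *
    linear_combination (-Γ01 * (a 1 * b 2 - b 1 * a 2)) * e0 -
      Γ01 * (a 2 * b 0 - b 2 * a 0) * e1 - Γ01 * (a 0 * b 1 - b 0 * a 1) * e2 -
      (a 0 * b 1 - b 0 * a 1) * u 2 * e3
  obtain ⟨hu0, hu1⟩ := eq_zero_of_smul_add_smul_eq_zero hC hrel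
  have hu0 : u 0 = Δ01 * u 2 * Γ12 / (Γ01 * Δ12) := by
    field_simp; linear_combination hu0
  have hu1 : u 1 = Δ01 * u 2 * Γ20 / (Γ01 * Δ20) := by
    field_simp; linear_combination hu1
  refine ⟨Δ01 * u 2 / Γ01, ContinuousLinearMap.ext fun v => ?_, ContinuousLinearMap.ext fun v => ?_⟩
  · refine mul_left_cancel₀ h01 ?_
    have e : Δ01 * α v = b 1 * (u 0 * c 0 (C v)) - b 0 * (u 1 * c 1 (C v)) := by
      rw [← hv, ← hv, hΔ01]; ring
    rw [e, hu0, hu1]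
    simp only [smul_apply, smul_eq_mul, ContinuousLinearMap.comp_apply, sub_apply]
    field_simp
  · refine mul_left_cancel₀ h01 ?_
    have e : Δ01 * β v = a 0 * (u 1 * c 1 (C v)) - a 1 * (u 0 * c 0 (C v)) := by
      rw [← hv, ← hv, hΔ01]; ring
    rw [e, hu0, hu1]
    simp only [smul_apply, smul_eq_mul, ContinuousLinearMap.comp_apply, sub_apply]
    field_simp

/-- A pencil containing a hexagonal `3`-web consists of the level sets of linear combinations of two
functions. -/
theorem RegularWeb.IsContainedIn.exists_eq_smul_fderiv {W : RegularWeb 3} {P : Pencil}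
    (hW : W.IsContainedIn P) (h : W.IsParallelizable) :
    ∃ μ f g : ℂ × ℂ → ℂ, AnalyticAt ℂ μ 0 ∧ AnalyticAt ℂ f 0 ∧ AnalyticAt ℂ g 0 ∧
      ∀ᶠ z in 𝓝 (0 : ℂ × ℂ), P.ωzero z = μ z • fderiv ℂ f z ∧ P.ωinfty z = μ z • fderiv ℂ g z := by
  obtain ⟨φ, hφ, c, hc⟩ := h
  obtain ⟨a, b, hab⟩ := hW.exists_coefficients
  have hpt : ∀ᶠ z in 𝓝 (0 : ℂ × ℂ),
      (∀ i j, i ≠ j → a i * b j - b i * a j ≠ 0 ∧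
        covectorWedge ((c i).comp (fderiv ℂ φ z)) ((c j).comp (fderiv ℂ φ z)) ≠ 0) ∧
      ∃ u : Fin 3 → ℂ, ∀ i, a i • P.ωzero z + b i • P.ωinfty z = u i • (c i).comp (fderiv ℂ φ z) := by
    have hw : ∀ᶠ z in 𝓝 (0 : ℂ × ℂ), ∀ i j, i ≠ j →
        (W.foliation i).form.wedge (W.foliation j).form z ≠ 0 := by
      simp only [Filter.eventually_all]
      exact fun i j h => W.eventually_wedge_ne_zero h
    filter_upwards [hab, Filter.eventually_all.2 fun i => (hc i).eventually_eq_smul, hw]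
      with z h1 h2 h3
    choose u hu h1 using h1
    choose u' hu' h2 using h2
    refine ⟨fun i j hij => ⟨fun h0 => h3 i j hij ?_, fun h0 => h3 i j hij ?_⟩,
      fun i => (u i)⁻¹ * u' i, fun i => ?_⟩
    · rw [OneForm.wedge_eq_covectorWedge, h1, h1, covectorWedge_smul_smul,
        covectorWedge_combination, h0, zero_mul, mul_zero]
    · rw [OneForm.wedge_eq_covectorWedge, h2, h2, covectorWedge_smul_smul, h0, mul_zero]
    · rw [mul_smul, ← h2, h1, inv_smul_smul₀ (hu i)]
  have hΔ : ∀ i j, i ≠ j → a i * b j - b i * a j ≠ 0 := fun i j hij =>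
    (hpt.self_of_nhds.1 i j hij).1
  have hΓ : ∀ i j, i ≠ j → covectorWedge (c i) (c j) ≠ 0 := fun i j hij h0 =>
    (hpt.self_of_nhds.1 i j hij).2 (by rw [covectorWedge_comp, h0, zero_mul])
  obtain ⟨D₀, D₁, hD⟩ := exists_common_multiple hΔ hΓ
  have hDφ : ∀ D : ℂ × ℂ →L[ℂ] ℂ, AnalyticAt ℂ (fun z => D (φ z)) 0 := fun D =>
    (D.analyticAt _).comp hφ.analyticAt
  have hfd : ∀ D : ℂ × ℂ →L[ℂ] ℂ, ∀ᶠ z in 𝓝 (0 : ℂ × ℂ),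
      fderiv ℂ (fun z => D (φ z)) z = D.comp (fderiv ℂ φ z) := fun D =>
    hφ.analyticAt.eventually_differentiableAt.mono fun z hz =>
      (D.hasFDerivAt.comp z hz.hasFDerivAt).fderiv
  let f : ℂ × ℂ → ℂ := fun z => D₀ (φ z)
  let g : ℂ × ℂ → ℂ := fun z => D₁ (φ z)
  have hmul : ∀ᶠ z in 𝓝 (0 : ℂ × ℂ), ∃ μ : ℂ,
      P.ωzero z = μ • fderiv ℂ f z ∧ P.ωinfty z = μ • fderiv ℂ g z := by
    filter_upwards [hpt, hfd D₀, hfd D₁] with z hz h0 h1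
    obtain ⟨u, hu⟩ := hz.2
    rw [h0, h1]
    exact hD _ _ _ u (hz.1 0 1 (by decide)).2 hu
  have hfg : ∀ {z : ℂ × ℂ} {μ : ℂ}, P.ωzero.wedge P.ωinfty z ≠ 0 → P.ωzero z = μ • fderiv ℂ f z →
      P.ωinfty z = μ • fderiv ℂ g z → OneForm.wedge (fderiv ℂ f) (fderiv ℂ g) z ≠ 0 := by
    intro z μ hδ h1 h2 h0
    refine hδ ?_
    rw [OneForm.wedge_eq_covectorWedge, h1, h2, covectorWedge_smul_smul,
      ← OneForm.wedge_eq_covectorWedge, h0, mul_zero]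
  -- So far `μ` exists only pointwise. Wedging `ω₀ = μ df` with `dg` expresses it as a quotient of
  -- analytic functions.
  refine ⟨fun z => P.ωzero.wedge (fderiv ℂ g) z / OneForm.wedge (fderiv ℂ f) (fderiv ℂ g) z,
    f, g, ?_, hDφ _, hDφ _, ?_⟩
  · obtain ⟨μ, h1, h2⟩ := hmul.self_of_nhds
    exact (OneForm.analyticAt_wedge P.analyticAt_zero (hDφ _).fderiv).div
      (OneForm.analyticAt_wedge (hDφ _).fderiv (hDφ _).fderiv) (hfg P.transversal h1 h2)
  · filter_upwards [hmul, OneForm.eventually_wedge_ne_zero P.analyticAt_zero P.analyticAt_infty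
      P.transversal] with z ⟨μ, h1, h2⟩ hδ
    have hne := hfg hδ h1 h2
    have hμ : P.ωzero.wedge (fderiv ℂ g) z / OneForm.wedge (fderiv ℂ f) (fderiv ℂ g) z = μ := by
      rw [div_eq_iff hne, OneForm.wedge_eq_covectorWedge, OneForm.wedge_eq_covectorWedge, h1]
      simpa using covectorWedge_smul_smul μ 1 (fderiv ℂ f z) (fderiv ℂ g z)
    rw [hμ]
    exact ⟨h1, h2⟩

/-- This is `d(μ df) = dμ ∧ df`, as second derivatives of `f` are symmetric. -/
theorem OneForm.eventually_curl_eq {ω : OneForm} {μ f : ℂ × ℂ → ℂ} (hμ : AnalyticAt ℂ μ 0)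
    (hf : AnalyticAt ℂ f 0) (h : ∀ᶠ z in 𝓝 (0 : ℂ × ℂ), ω z = μ z • fderiv ℂ f z) :
    ∀ᶠ z in 𝓝 (0 : ℂ × ℂ), fderiv ℂ ω.coeffY z (1, 0) - fderiv ℂ ω.coeffX z (0, 1) =
      fderiv ℂ μ z (1, 0) * fderiv ℂ f z (0, 1) - fderiv ℂ μ z (0, 1) * fderiv ℂ f z (1, 0) := by
  filter_upwards [h.eventually_nhds, hμ.eventually_differentiableAt,
    hf.fderiv.eventually_differentiableAt, isClosedNearZero_fderiv hf] with z hz hμz hfz hs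
  have hd : HasFDerivAt ω (μ z • fderiv ℂ (fderiv ℂ f) z + (fderiv ℂ μ z).smulRight (fderiv ℂ f z))
      z := (hμz.hasFDerivAt.smul hfz.hasFDerivAt).congr_of_eventuallyEq hz
  rw [fderiv_coeffX hd.differentiableAt, fderiv_coeffY hd.differentiableAt, hd.fderiv]
  simp only [add_apply, smul_apply, smul_eq_mul, ContinuousLinearMap.smulRight_apply]
  linear_combination μ z * hs (1, 0) (0, 1)

/-- From `dω₀ = dμ ∧ df = d log μ ∧ ω₀`, and likewise for `ω_∞`, uniqueness of `η` gives `η = d log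
μ`, which is closed. -/
theorem Pencil.isTorsionFree_of_eq_smul_fderiv {P : Pencil} {μ f g : ℂ × ℂ → ℂ}
    (hμ : AnalyticAt ℂ μ 0) (hf : AnalyticAt ℂ f 0) (hg : AnalyticAt ℂ g 0)
    (h : ∀ᶠ z in 𝓝 (0 : ℂ × ℂ), P.ωzero z = μ z • fderiv ℂ f z ∧ P.ωinfty z = μ z • fderiv ℂ g z) :
    P.IsTorsionFree := by
  have hδ : ∀ᶠ z in 𝓝 (0 : ℂ × ℂ), P.ωzero.wedge P.ωinfty z ≠ 0 ∧ P.ωzero.wedge P.ωinfty z =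
      μ z * μ z * covectorWedge (fderiv ℂ f z) (fderiv ℂ g z) := by
    filter_upwards [h, OneForm.eventually_wedge_ne_zero P.analyticAt_zero P.analyticAt_infty
      P.transversal] with z hz hz'
    refine ⟨hz', ?_⟩
    rw [OneForm.wedge_eq_covectorWedge, hz.1, hz.2, covectorWedge_smul_smul]
  -- As `δ = μ² df ∧ dg` does not vanish, neither does `μ`.
  have hμ0 : ∀ᶠ z in 𝓝 (0 : ℂ × ℂ), μ z ≠ 0 :=
    hδ.mono fun z hz h0 => hz.1 (by rw [hz.2, h0]; ring)
  rw [isTorsionFree_iff_commonFactor]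
  refine (isClosedNearZero_logDeriv hμ hμ0.self_of_nhds).congr ?_
  filter_upwards [h, hδ, hμ0, OneForm.eventually_curl_eq hμ hf (h.mono fun z hz => hz.1),
    OneForm.eventually_curl_eq hμ hg (h.mono fun z hz => hz.2),
    P.analyticAt_zero.eventually_differentiableAt,
    P.analyticAt_infty.eventually_differentiableAt] with z hz hδ hμ0 hcf hcg hd₀ hd₁
  have hfst := commonFactor_apply_fst hd₀ hd₁ hδ.1
  have hsnd := commonFactor_apply_snd hd₀ hd₁ hδ.1
  have hX₀ : P.ωzero.coeffX z = μ z * fderiv ℂ f z (1, 0) := DFunLike.congr_fun hz.1 _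
  have hY₀ : P.ωzero.coeffY z = μ z * fderiv ℂ f z (0, 1) := DFunLike.congr_fun hz.1 _
  have hX₁ : P.ωinfty.coeffX z = μ z * fderiv ℂ g z (1, 0) := DFunLike.congr_fun hz.2 _
  have hY₁ : P.ωinfty.coeffY z = μ z * fderiv ℂ g z (0, 1) := DFunLike.congr_fun hz.2 _
  rw [hcf, hcg, hX₀, hX₁] at hfst
  rw [hcf, hcg, hY₀, hY₁] at hsnd
  refine (covector_ext ?_ ?_).symm
  · refine mul_right_cancel₀ hδ.1 ?_
    rw [hfst, hδ.2, covectorWedge, smul_apply, smul_eq_mul]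
    field_simp
    ring
  · refine mul_right_cancel₀ hδ.1 ?_
    rw [hsnd, hδ.2, covectorWedge, smul_apply, smul_eq_mul]
    field_simp
    ring

/-- The first three foliations already determine the pencil up to a common factor of the forms and a
constant change of basis. -/
theorem RegularWeb.IsContainedIn.isTorsionFree {d : ℕ} (hd : 3 ≤ d) {W : RegularWeb d} {P : Pencil}
    (hW : W.IsContainedIn P) (h : W.IsHexagonal) : P.IsTorsionFree := by
  have hW' : (W.extract (Fin.castLEEmb hd)).IsContainedIn P := fun i => hW (Fin.castLEEmb hd i)
  obtain ⟨μ, f, g, hμ, hf, hg, hfg⟩ := hW'.exists_eq_smul_fderiv (h (Fin.castLEEmb hd))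
  exact P.isTorsionFree_of_eq_smul_fderiv hμ hf hg hfg

end PlaneWeb

theorem mainTheorem7 (d : ℕ) (hd : 3 < d) (W : PlaneWeb.RegularWeb d) :
    ((∃ P : PlaneWeb.Pencil, W.IsContainedIn P) ↔ W.HasConstantCrossRatio) ∧
    (W.HasConstantCrossRatio → ∀ P : PlaneWeb.Pencil, W.IsContainedIn P →
      [W.IsParallelizable, W.IsHexagonal, P.IsTorsionFree].TFAE) := by
  refine ⟨⟨fun ⟨P, hP⟩ => hP.hasConstantCrossRatio, fun h => h.exists_pencil hd⟩,
    fun _ P hP => ?_⟩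
  tfae_have 1 → 2 := fun h => h.isHexagonal
  tfae_have 2 → 3 := fun h => hP.isTorsionFree hd.le h
  tfae_have 3 → 1 := fun h => hP.isParallelizable h
  tfae_finish
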